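/- Let $\mathbb{F}_q$ be a finite field, $R=\mathbb{F}_q[T]$ and $k=\mathbb{F}_q(T)$. For a square-free polynomial $D\in R$ let $H(D)$ be the ideal class group (fractional ideals modulo principal fractional ideals) of the integral closure of $R$ in $K=k(\sqrt D)$. Let $n\ge 1$ be an integer and let $Z\in R$ be any non-constant polynomial. **Theorem 2.** If $D$ is monic and square-free and has one of the forms 1. $D=Z^{2n}+1$; 2. $D=(Z^n+F-1)^2+4F$, where $F\in R$, $F\mid Z^n-1$ and $Z^n+F-1\neq 0$; 3. $D=(Z^n-F+1)^2+4F$, where $F\in R$, $F\mid Z^n+1$ and $Z^n-F+1\neq 0$; 4. $D=(4Z^n+F-1)^2+4F$, where $F\in R$, $F\mid 4Z^n-1$ and $4Z^n+F-1\neq 0$, then $H(D)$ contains a (cyclic) subgroup of order $n$. In general, for any square-free $$D=(Z^n+aF-b)^2+4abF,\qquad a,b\in\mathbb{F}_q^\times,\quad F\in R,\quad F\mid Z^n-b,\quad Z^n+aF-b\neq 0,$$ the group $H(D)$ contains a (cyclic) subgroup of order $n$. -/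

import Mathlib

open Polynomial

/-- `K = k(√D)`, where `k = 𝔽_q(T)` and `D ∈ R = 𝔽_q[T]`: the field `K` is generated over `k` by an
element whose square is `D`. -/
def IsAdjoinSqrt (Fq K : Type*) [Field Fq] [Field K] [Algebra Fq[X] K] [Algebra (RatFunc Fq) K]
    (D : Fq[X]) : Prop :=
  ∃ δ : K, δ ^ 2 = algebraMap Fq[X] K D ∧ IntermediateField.adjoin (RatFunc Fq) {δ} = ⊤

/-- The ideal class group `H(K)` (fractional ideals modulo principal ones) of the integral closure
of `R = 𝔽_q[T]` in `K`. -/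
abbrev IdealClassGroup (Fq K : Type*) [Field Fq] [Field K] [Algebra Fq[X] K] : Type _ :=
  ClassGroup (FunctionField.ringOfIntegers Fq K)

/-- The ideal class group of `K` contains a cyclic subgroup of order `n`. -/
def HasCyclicClassSubgroup (Fq K : Type*) [Field Fq] [Field K] [Algebra Fq[X] K] (n : ℕ) : Prop :=
  ∃ S : Subgroup (IdealClassGroup Fq K), IsCyclic S ∧ Nat.card S = n

/-! Put A = Z^n + aF - b. Besides D = A² + 4abF there is the identity D = (A + 2b)² - 4bZ^n, so α =
A + 2b + √D has norm 4bZ^n. Square-freeness makes α coprime to its conjugate when n ≥ 2, hence (α) =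
I^n, and the class of I is to have order exactly n.

If I^m = (β) with 0 < m < n, then β = u + v√D divides α and has norm cZ^m, of degree less than deg
A. Since F ∣ A, the continued fraction of √D is very short, so such small norms come only from
obvious solutions: `exists_common_dvd_of_small_value` proves this by descent, and
`exists_common_factor_of_norm_eq` deduces that u and v share a nonunit factor. That factor would
divide the √D-coefficient 1 of α, which is absurd.

The ideal argument is `exists_orderOf_eq_of_quadraticAlgebra`; `nonempty_quadraticAlgebra_ringEquiv`
identifies the ring of integers with k[T][√D]. Characteristic two does not occur, as D would not be
square-free. -/

/-! ### Small values of the norm form -/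

/-- Descent for the form `G u² - (G B² + κ G') v²`: a value of small degree is, up to a constant,
a square times `G` or `G'`, the square root being a common divisor of `u` and `v`. -/
theorem exists_common_dvd_of_small_value {k : Type*} [Field k] (h2 : (2 : k) ≠ 0) {κ : k}
    (hκ : κ ≠ 0) (d : ℕ) :
    ∀ (G G' B B' u v N : k[X]), G * B = G' * B' → G.natDegree < (G * B).natDegree →
      G'.natDegree < (G * B).natDegree → N.natDegree < (G * B).natDegree → v.degree < d →
      G * u ^ 2 - (G * B ^ 2 + C κ * G') * v ^ 2 = N →
      ∃ (x : k[X]) (c : k), x ∣ u ∧ x ∣ v ∧ (N = C c * G * x ^ 2 ∨ N = C c * G' * x ^ 2) := by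
  have hκκ : C κ * C κ⁻¹ = 1 := by rw [← C_mul, mul_inv_cancel₀ hκ, C_1]
  induction d with
  | zero =>
    intro G G' B B' u v N _ _ _ _ hv hN
    have hv : v = 0 := by simpa [Nat.WithBot.lt_zero_iff] using hv
    subst hv
    exact ⟨u, 1, dvd_rfl, dvd_zero _, Or.inl (by rw [← hN, C_1]; ring)⟩
  | succ d ih =>
    intro G G' B B' u v N hB hG hG' hNd hv hN
    by_cases hv0 : v = 0
    · subst hv0
      exact ⟨u, 1, dvd_rfl, dvd_zero _, Or.inl (by rw [← hN, C_1]; ring)⟩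
    have hA0 : G * B ≠ 0 := by
      intro h
      simp [h] at hG
    -- With the sign of u chosen so that u + Bv has no cancellation, w = u - Bv satisfies w · G(u +
    -- Bv) = N + κG'v², which forces deg w < deg v.
    have step : ∀ u : k[X], G * u ^ 2 - (G * B ^ 2 + C κ * G') * v ^ 2 = N →
        (G * B * v).natDegree ≤ (G * u + G * B * v).natDegree →
        ∃ (x : k[X]) (c : k), x ∣ u ∧ x ∣ v ∧ (N = C c * G * x ^ 2 ∨ N = C c * G' * x ^ 2) := by
      intro u hN hdeg
      set w := u - B * v with hw
      have hprod : w * (G * u + G * B * v) = N + C κ * G' * v ^ 2 := by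
        rw [← hN, hw]; ring
      have hwv : w.degree < v.degree := by
        by_cases hw0 : w = 0
        · rw [hw0, degree_zero]; exact bot_lt_iff_ne_bot.2 (mt degree_eq_bot.1 hv0)
        refine degree_lt_degree ?_
        by_contra! hle
        have hT : G * u + G * B * v ≠ 0 := by
          intro h
          rw [h, natDegree_zero, natDegree_mul hA0 hv0] at hdeg
          omega
        have h1 := congrArg natDegree hprod
        rw [natDegree_mul hw0 hT] at h1
        rw [natDegree_mul hA0 hv0] at hdeg
        have h3 := natDegree_add_le N (C κ * G' * v ^ 2)
        have h4 : (C κ * G' * v ^ 2).natDegree ≤ G'.natDegree + 2 * v.natDegree := by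
          refine natDegree_mul_le.trans (add_le_add (natDegree_C_mul_le _ _) ?_)
          rw [natDegree_pow]
        rcases le_max_iff.1 h3 with h | h <;> omega
      have hwd : w.degree < d := by
        rw [degree_eq_natDegree hv0] at hv hwv
        have : v.natDegree < d + 1 := by exact_mod_cast hv
        exact hwv.trans_le (by exact_mod_cast (by omega : v.natDegree ≤ d))
      -- Substituting u = w + Bv, multiplying by -κ and completing the square in v exchanges G and
      -- G', because GB = G'B'.
      have hN' : G' * (-B' * w + C κ * v) ^ 2 - (G' * B' ^ 2 + C κ * G) * w ^ 2 = -C κ * N := by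
        rw [← hN, hw]
        linear_combination (2 * C κ * v * (u - B * v)) * hB
      obtain ⟨x, c, hxu, hxw, hx⟩ := ih G' G B' B (-B' * w + C κ * v) w (-C κ * N) hB.symm
        (hB ▸ hG') (hB ▸ hG)
        (by rw [← C_neg, ← hB]; exact (natDegree_C_mul_le _ _).trans_lt hNd) hwd hN'
      have hxv : x ∣ v := by
        have h : x ∣ C κ * v := by
          have := dvd_add hxu (hxw.mul_left B')
          rwa [show -B' * w + C κ * v + B' * w = C κ * v by ring] at this
        have := h.mul_left (C κ⁻¹)
        rwa [show C κ⁻¹ * (C κ * v) = v by linear_combination v * hκκ] at this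
      refine ⟨x, -κ⁻¹ * c, ?_, hxv, ?_⟩
      · have := dvd_add hxw (hxv.mul_left B)
        rwa [hw, sub_add_cancel] at this
      · rw [C_mul, C_neg]
        rcases hx with h | h
        · right; linear_combination (-C κ⁻¹) * h - N * hκκ
        · left; linear_combination (-C κ⁻¹) * h - N * hκκ
    by_cases hdeg : (G * B * v).natDegree ≤ (G * u + G * B * v).natDegree
    · exact step u hN hdeg
    -- The two candidates for u sum to 2GBv, so one of them has degree at least deg GBv.
    · obtain ⟨x, c, hxu, hx⟩ := step (-u) (by rw [neg_sq, hN]) (by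
        by_contra! h
        push Not at hdeg
        have e : (G * u + G * B * v) + (G * -u + G * B * v) = C 2 * (G * B * v) := by
          rw [show (C 2 : k[X]) = 2 from rfl]; ring
        have h1 := natDegree_add_le (G * u + G * B * v) (G * -u + G * B * v)
        rw [e, natDegree_C_mul h2] at h1
        rcases le_max_iff.1 h1 with h | h <;> omega)
      exact ⟨x, c, (dvd_neg.1 hxu), hx⟩

/-- Leading terms could cancel only if deg F = deg W, but then the nonzero multiple W + aF - b of F
cannot have smaller degree than F. -/
theorem natDegree_eq_of_dvd {k : Type*} [Field k] {W F : k[X]} {a b : k}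
    (hW : 0 < W.natDegree) (ha : a ≠ 0) (hF : F ∣ W - C b) (hA : W + C a * F - C b ≠ 0) :
    F ∣ W + C a * F - C b ∧ F ≠ 0 ∧ F.natDegree ≤ W.natDegree ∧
      (W + C a * F - C b).natDegree = W.natDegree := by
  have hd : (W - C b).natDegree = W.natDegree := natDegree_sub_C
  have hWb : W - C b ≠ 0 := by
    intro h
    rw [h, natDegree_zero] at hd
    omega
  have hF0 : F ≠ 0 := by
    rintro rfl
    exact hWb (zero_dvd_iff.1 hF)
  have hFA : F ∣ W + C a * F - C b := by
    have := dvd_add hF (Dvd.intro_left (C a) rfl : F ∣ C a * F)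
    rwa [show W - C b + C a * F = W + C a * F - C b by ring] at this
  have hFd : F.natDegree ≤ W.natDegree := hd ▸ natDegree_le_of_dvd hF hWb
  have hFd' := natDegree_le_of_dvd hFA hA
  have e : W + C a * F - C b = (W - C b) + C a * F := by ring
  have haF : (C a * F).natDegree = F.natDegree := natDegree_C_mul ha
  refine ⟨hFA, hF0, hFd, ?_⟩
  rcases hFd.lt_or_eq with h | h
  · rw [e, natDegree_add_eq_left_of_natDegree_lt (by omega), hd]
  · refine le_antisymm ?_ (h ▸ hFd')
    rw [e]
    refine (natDegree_add_le _ _).trans ?_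
    omega

theorem natDegree_discriminant_pos {k : Type*} [Field k] {W F : k[X]} {a b : k}
    (hW : 0 < W.natDegree) (ha : a ≠ 0) (hF : F ∣ W - C b) (hA : W + C a * F - C b ≠ 0) :
    0 < ((W + C a * F - C b) ^ 2 + 4 * C a * C b * F).natDegree := by
  obtain ⟨-, -, h1, h2⟩ := natDegree_eq_of_dvd hW ha hF hA
  have h3 : ((W + C a * F - C b) ^ 2).natDegree = 2 * W.natDegree := by
    rw [natDegree_pow, h2]
  have h4 : (4 * C a * C b * F).natDegree ≤ F.natDegree := by
    rw [show (4 * C a * C b : k[X]) = C (4 * a * b) by rw [C_mul, C_mul]; rfl]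
    exact natDegree_C_mul_le _ _
  rw [natDegree_add_eq_left_of_natDegree_lt (by omega)]
  omega

/-- No solution of `u² - D v² = c Z^m` with `0 < m < n` is primitive. -/
theorem exists_common_factor_of_norm_eq {k : Type*} [Field k] (h2 : (2 : k) ≠ 0) {Z F u v : k[X]}
    {a b c : k} {m n : ℕ} (hm : 0 < m) (hmn : m < n) (hZ : 0 < Z.natDegree) (ha : a ≠ 0)
    (hb : b ≠ 0) (hc : c ≠ 0) (hF : F ∣ Z ^ n - C b) (hA : Z ^ n + C a * F - C b ≠ 0)
    (h : u ^ 2 - ((Z ^ n + C a * F - C b) ^ 2 + 4 * C a * C b * F) * v ^ 2 = C c * Z ^ m) :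
    ∃ x : k[X], ¬ IsUnit x ∧ x ∣ u ∧ x ∣ v := by
  have hW : (Z ^ n).natDegree = n * Z.natDegree := natDegree_pow _ _
  have hW0 : 0 < (Z ^ n).natDegree := hW ▸ Nat.mul_pos (by omega) hZ
  obtain ⟨hFA, hF0, hFd, hAd⟩ := natDegree_eq_of_dvd hW0 ha hF hA
  have hNd : (C c * Z ^ m).natDegree = m * Z.natDegree := by
    rw [natDegree_C_mul hc, natDegree_pow]
  have hlt : m * Z.natDegree < n * Z.natDegree := Nat.mul_lt_mul_of_pos_right hmn hZ
  have hNpos : 0 < m * Z.natDegree := Nat.mul_pos hm hZ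
  have h4 : (4 : k) ≠ 0 := by
    rw [show (4 : k) = 2 * 2 by norm_num]; exact mul_ne_zero h2 h2
  have hC4 : (C 4 : k[X]) = 4 := rfl
  set A := Z ^ n + C a * F - C b with hAdef
  have sq_case : ∀ (x : k[X]) (c' : k), C c * Z ^ m = C c' * 1 * x ^ 2 → ¬ IsUnit x := by
    rintro x c' hx hu
    have h0 : (C c' * 1 * x ^ 2).natDegree = 0 := by
      refine Nat.le_zero.1 (natDegree_mul_le.trans ?_)
      rw [mul_one, natDegree_C, natDegree_pow, natDegree_eq_zero_of_isUnit hu]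
    rw [← hx] at h0
    omega
  rcases hFd.lt_or_eq with hlt' | heq
  -- Descent with G = 1, G' = F, B' = A/F and κ = 4ab.
  · obtain ⟨B, hB⟩ := hFA
    obtain ⟨x, c', hxu, hxv, hx⟩ := exists_common_dvd_of_small_value h2
      (mul_ne_zero (mul_ne_zero h4 ha) hb) (v.natDegree + 1) 1 F A B u v (C c * Z ^ m)
      (by rw [one_mul, hB]) (by rw [one_mul, natDegree_one]; omega) (by rw [one_mul]; omega)
      (by rw [one_mul]; omega)
      (degree_le_natDegree.trans_lt (by exact_mod_cast Nat.lt_succ_self _))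
      (by rw [← h]; simp only [C_mul, hC4]; ring)
    refine ⟨x, ?_, hxu, hxv⟩
    rcases hx with hx | hx
    · exact sq_case x c' hx
    -- If x were a unit, Z would divide F, hence Z^n - b, hence the constant b.
    · intro hu
      have hc' : c' ≠ 0 := by
        rintro rfl
        rw [C_0, zero_mul, zero_mul] at hx
        rw [hx, natDegree_zero] at hNd
        omega
      have hZF : Z ∣ F := by
        have h1 : Z ∣ C c * Z ^ m := (dvd_pow_self Z hm.ne').mul_left _
        rw [hx, (hu.pow 2).dvd_mul_right, (isUnit_C.2 hc'.isUnit).dvd_mul_left] at h1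
        exact h1
      have h1 : Z ∣ C b := by
        have := dvd_sub (dvd_pow_self Z (by omega : n ≠ 0)) (hZF.trans hF)
        rwa [sub_sub_cancel] at this
      have := natDegree_eq_zero_of_isUnit (isUnit_of_dvd_unit h1 (isUnit_C.2 hb.isUnit))
      omega
  · obtain ⟨B, hB⟩ := hFA
    have hB0 : B ≠ 0 := by
      rintro rfl
      exact hA (by rw [hB, mul_zero])
    have hBd : B.natDegree = 0 := by
      have := congrArg natDegree hB
      rw [natDegree_mul hF0 hB0] at this
      omega
    obtain ⟨e, rfl⟩ := natDegree_eq_zero.1 hBd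
    have he : e ≠ 0 := by
      rintro rfl
      exact hB0 C_0
    have hee : C e * C e⁻¹ = 1 := by rw [← C_mul, mul_inv_cancel₀ he, C_1]
    -- Here deg F is too large for the descent, but A = eF with e constant, so D = (A + 2ab/e)² -
    -- (2ab/e)² and the descent runs with G = G' = 1.
    set A' := A + C (2 * a * b * e⁻¹) with hA'
    have hA'd : A'.natDegree = A.natDegree := natDegree_add_C
    have hC2 : (C 2 : k[X]) = 2 := rfl
    obtain ⟨x, c', hxu, hxv, hx⟩ := exists_common_dvd_of_small_value h2
      (κ := -(2 * a * b * e⁻¹) ^ 2) (by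
        refine neg_ne_zero.2 (pow_ne_zero _ ?_)
        exact mul_ne_zero (mul_ne_zero (mul_ne_zero h2 ha) hb) (inv_ne_zero he))
      (v.natDegree + 1) 1 1 A' A' u v (C c * Z ^ m) rfl
      (by rw [one_mul, natDegree_one]; omega) (by rw [one_mul, natDegree_one]; omega)
      (by rw [one_mul]; omega)
      (degree_le_natDegree.trans_lt (by exact_mod_cast Nat.lt_succ_self _))
      (by
        rw [← h, hA', hB]
        simp only [C_mul, C_neg, C_pow, hC2]
        linear_combination (-4 * C a * C b * F * v ^ 2) * hee)
    exact ⟨x, hx.elim (sq_case x c') (sq_case x c'), hxu, hxv⟩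

/-! ### An ideal class of order n -/

theorem isCoprime_of_squarefree_sq_sub {k : Type*} [Field k] {Z A D E : k[X]} {n : ℕ}
    (hn : 2 ≤ n) (hD : Squarefree D) (h : D = A ^ 2 - E * Z ^ n) : IsCoprime Z A := by
  classical
  rw [← EuclideanDomain.gcd_isUnit_iff]
  refine hD _ ?_
  rw [h, ← sq]
  exact dvd_sub (pow_dvd_pow_of_dvd (EuclideanDomain.gcd_dvd_right Z A) 2)
    (((pow_dvd_pow_of_dvd (EuclideanDomain.gcd_dvd_left Z A) 2).trans
      (pow_dvd_pow Z hn)).mul_left _)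

/-- An ideal class has order `n` if the `n`th power of the ideal is principal and no smaller
positive power is. -/
theorem exists_orderOf_eq_of_isPrincipal_pow {O : Type*} [CommRing O] [IsDedekindDomain O]
    {n : ℕ} (hn : 0 < n) {I : Ideal O} (hI : I ≠ ⊥) (hIn : (I ^ n).IsPrincipal)
    (hIm : ∀ m, 0 < m → m < n → ¬ (I ^ m).IsPrincipal) : ∃ g : ClassGroup O, orderOf g = n := by
  have hI' : I ∈ nonZeroDivisors (Ideal O) := mem_nonZeroDivisors_of_ne_zero hI
  have key : ∀ m, ClassGroup.mk0 (⟨I, hI'⟩ : nonZeroDivisors (Ideal O)) ^ m = 1 ↔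
      (I ^ m).IsPrincipal := by
    intro m
    rw [← map_pow, ← ClassGroup.mk0_eq_one_iff (pow_mem hI' m)]
    rfl
  refine ⟨ClassGroup.mk0 ⟨I, hI'⟩, (orderOf_eq_iff hn).2 ⟨(key n).2 hIn, ?_⟩⟩
  intro m hmn hm h
  exact hIm m hm hmn ((key m).1 h)

theorem exists_pow_eq_span_singleton {O : Type*} [CommRing O] [IsDedekindDomain O] {n : ℕ}
    {x y z : O} (hxy : IsCoprime x y) (h : Associated (x * y) (z ^ n)) :
    ∃ I : Ideal O, I ^ n = Ideal.span {x} := by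
  classical
  let _ : GCDMonoid (Ideal O) := UniqueFactorizationMonoid.toGCDMonoid (Ideal O)
  obtain ⟨I, hI⟩ := exists_eq_pow_of_mul_eq_pow_of_coprime (R := Ideal O)
    (a := Ideal.span {x}) (b := Ideal.span {y}) (c := Ideal.span {z}) (n := n)
    ((Ideal.isCoprime_span_singleton_iff x y).2 hxy) (by
      rw [Ideal.span_singleton_mul_span_singleton, Ideal.span_singleton_pow,
        Ideal.span_singleton_eq_span_singleton]
      exact h)
  exact ⟨I, hI.symm⟩

theorem exists_orderOf_eq_of_quadraticAlgebra {k O : Type*} [Field k] [CommRing O]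
    [IsDedekindDomain O] (h2 : (2 : k) ≠ 0) {Z F D : k[X]} {a b : k} {n : ℕ} (hn : 2 ≤ n)
    (hZ : 0 < Z.natDegree) (ha : a ≠ 0) (hb : b ≠ 0) (hF : F ∣ Z ^ n - C b)
    (hA : Z ^ n + C a * F - C b ≠ 0) (hD : Squarefree D)
    (hDeq : D = (Z ^ n + C a * F - C b) ^ 2 + 4 * C a * C b * F)
    (e : QuadraticAlgebra k[X] D 0 ≃+* O) : ∃ g : ClassGroup O, orderOf g = n := by
  have h4 : (4 : k) ≠ 0 := by
    rw [show (4 : k) = 2 * 2 by norm_num]; exact mul_ne_zero h2 h2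
  have h4b : IsUnit (C (4 * b)) := isUnit_C.2 (mul_ne_zero h4 hb).isUnit
  have hC4b : C (4 * b) = 4 * C b := by rw [C_mul]; rfl
  set A := Z ^ n + C a * F + C b with hAdef
  have hDA : D = A ^ 2 - C (4 * b) * Z ^ n := by
    rw [hDeq, hAdef, hC4b]; ring
  have hcop : IsCoprime Z A := isCoprime_of_squarefree_sq_sub hn hD hDA
  set α : QuadraticAlgebra k[X] D 0 := ⟨A, 1⟩ with hα
  set α' : QuadraticAlgebra k[X] D 0 := ⟨A, -1⟩ with hα'
  have hnorm : α * α' = QuadraticAlgebra.C (C (4 * b) * Z ^ n) := by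
    ext
    · simp only [hα, hα', QuadraticAlgebra.re_mul, QuadraticAlgebra.re_C, hDA]; ring_nf
    · simp only [hα, hα', QuadraticAlgebra.im_mul, QuadraticAlgebra.im_C]; ring_nf
  have hαnorm : α.norm = C (4 * b) * Z ^ n := by
    simp only [QuadraticAlgebra.norm_def, hα, hDA]; ring_nf
  -- The norm αα' and the trace α + α' = 2A are already coprime in k[T].
  have hcop' : IsCoprime α α' := by
    have h1 : IsCoprime (C (4 * b) * Z ^ n) (C 2 * A) :=
      (isCoprime_mul_unit_left_left h4b _ _).2
        ((isCoprime_mul_unit_left_right (isUnit_C.2 h2.isUnit) _ _).2 hcop.pow_left)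
    obtain ⟨s, t, hst⟩ := h1.map (algebraMap k[X] (QuadraticAlgebra k[X] D 0))
    have h3 : algebraMap k[X] (QuadraticAlgebra k[X] D 0) (C 2 * A) = α + α' := by
      ext
      · simp only [hα, hα', QuadraticAlgebra.re_add, QuadraticAlgebra.algebraMap_re]
        rw [show (C 2 : k[X]) = 2 from rfl]; ring_nf
      · simp [hα, hα']
    rw [← QuadraticAlgebra.C_eq_algebraMap, ← hnorm, QuadraticAlgebra.C_eq_algebraMap, h3] at hst
    exact ⟨s * α' + t, t, by linear_combination hst⟩
  have hassoc : Associated (e α * e α') (e (QuadraticAlgebra.C Z) ^ n) := by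
    rw [← map_mul, ← map_pow, ← QuadraticAlgebra.C_pow, hnorm, QuadraticAlgebra.C_mul, map_mul]
    exact associated_unit_mul_left _ _
      ((h4b.map (algebraMap k[X] (QuadraticAlgebra k[X] D 0))).map e)
  obtain ⟨I, hI⟩ := exists_pow_eq_span_singleton (hcop'.map e.toRingHom) hassoc
  replace hI : I ^ n = Ideal.span {e α} := hI
  have hI0 : I ≠ ⊥ := by
    rintro rfl
    rw [← Ideal.zero_eq_bot, zero_pow (by omega), Ideal.zero_eq_bot, eq_comm,
      Ideal.span_singleton_eq_bot, map_eq_zero_iff e e.injective] at hI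
    exact one_ne_zero (congrArg QuadraticAlgebra.im hI)
  refine exists_orderOf_eq_of_isPrincipal_pow (by omega) hI0 ⟨⟨_, hI⟩⟩ ?_
  rintro m hm hmn ⟨⟨y, hy⟩⟩
  rw [← Ideal.span] at hy
  obtain ⟨β, rfl⟩ := e.surjective y
  have hβα : Associated (β ^ n) (α ^ m) := by
    have : Ideal.span {e (β ^ n)} = Ideal.span {e (α ^ m)} := by
      rw [map_pow, map_pow, ← Ideal.span_singleton_pow, ← Ideal.span_singleton_pow, ← hy, ← hI,
        ← pow_mul, ← pow_mul, mul_comm]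
    rw [Ideal.span_singleton_eq_span_singleton] at this
    simpa using this.map e.symm
  have hβdvd : β ∣ α := by
    have h1 : e α ∈ Ideal.span {e β} := by
      rw [← hy]
      exact Ideal.pow_le_pow_right hmn.le (hI ▸ Ideal.mem_span_singleton_self _)
    have := map_dvd e.symm (Ideal.mem_span_singleton.1 h1)
    simpa using this
  -- Norms of β^n ~ α^m; the n-th powers are then removed by unique factorization in k[T].
  have hβnorm : Associated (β.norm ^ n) ((Z ^ m) ^ n) := by
    have h1 := hβα.map QuadraticAlgebra.norm
    rw [map_pow, map_pow, hαnorm, mul_pow, ← pow_mul, mul_comm n m, pow_mul] at h1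
    exact h1.trans (associated_unit_mul_left _ _ (h4b.pow m))
  have hβZ : Associated (Z ^ m) β.norm :=
    associated_of_dvd_dvd
      ((UniqueFactorizationMonoid.pow_dvd_pow_iff_dvd (by omega)).1 hβnorm.symm.dvd)
      ((UniqueFactorizationMonoid.pow_dvd_pow_iff_dvd (by omega)).1 hβnorm.dvd)
  obtain ⟨ε, hε⟩ := hβZ
  obtain ⟨c, hc, hcε⟩ := Polynomial.isUnit_iff.1 ε.isUnit
  obtain ⟨x, hx, hxu, hxv⟩ := exists_common_factor_of_norm_eq (u := β.re) (v := β.im) h2 hm hmn hZ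
    ha hb hc.ne_zero hF hA (by
      rw [← hDeq, hcε, mul_comm (ε : k[X]), hε, QuadraticAlgebra.norm_def]; ring_nf)
  obtain ⟨γ, hγ⟩ := hβdvd
  refine hx (isUnit_of_dvd_one ?_)
  have him := congrArg QuadraticAlgebra.im hγ
  rw [QuadraticAlgebra.im_mul] at him
  change 1 = _ at him
  rw [him, zero_mul, zero_mul, add_zero]
  exact dvd_add (hxu.mul_right _) (hxv.mul_right _)

/-! ### The ring of integers of k(T)(√D) -/

theorem not_isSquare_algebraMap_ratFunc {k : Type*} [Field k] {D : k[X]} (hD : Squarefree D)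
    (hdeg : 0 < D.natDegree) (r : RatFunc k) : r ^ 2 ≠ algebraMap k[X] (RatFunc k) D := by
  intro h
  obtain ⟨s, rfl⟩ := IsIntegrallyClosed.isIntegral_iff.1
    (IsIntegral.of_pow zero_lt_two (h ▸ isIntegral_algebraMap) : IsIntegral k[X] r)
  rw [← map_pow] at h
  have h := IsFractionRing.injective k[X] (RatFunc k) h
  have hu : IsUnit s := hD s (by rw [← h, sq])
  have := natDegree_eq_zero_of_isUnit (hu.pow 2)
  rw [h] at this
  omega

/-- Dq has square Dt, so it is integral, hence a polynomial s; then D ∣ s² gives D ∣ s because D is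
square-free. -/
theorem exists_polynomial_of_mul_sq {k : Type*} [Field k] {D t : k[X]} (hD : Squarefree D)
    {q : RatFunc k} (h : algebraMap k[X] (RatFunc k) D * q ^ 2 = algebraMap k[X] (RatFunc k) t) :
    ∃ r, algebraMap k[X] (RatFunc k) r = q := by
  have hD0 : algebraMap k[X] (RatFunc k) D ≠ 0 :=
    (map_ne_zero_iff _ (IsFractionRing.injective k[X] (RatFunc k))).2 hD.ne_zero
  have h1 : (algebraMap k[X] (RatFunc k) D * q) ^ 2 = algebraMap k[X] (RatFunc k) (D * t) := by
    rw [map_mul, ← h]; ring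
  obtain ⟨s, hs⟩ := IsIntegrallyClosed.isIntegral_iff.1
    (IsIntegral.of_pow zero_lt_two (h1 ▸ isIntegral_algebraMap) :
      IsIntegral k[X] (algebraMap k[X] (RatFunc k) D * q))
  rw [← hs, ← map_pow] at h1
  have h1 := IsFractionRing.injective k[X] (RatFunc k) h1
  obtain ⟨r, rfl⟩ := (hD.dvd_pow_iff_dvd two_ne_zero).1 (Dvd.intro t h1.symm)
  exact ⟨r, mul_left_cancel₀ hD0 (by rw [← hs, map_mul])⟩

section

variable {k K : Type*} [Field k] [Field K] [Algebra k[X] K] [Algebra (RatFunc k) K]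
  [IsScalarTower k[X] (RatFunc k) K] {D : k[X]} {δ : K}

theorem exists_eq_add_mul_of_adjoin_eq_top (hδ : δ ^ 2 = algebraMap k[X] K D)
    (htop : IntermediateField.adjoin (RatFunc k) {δ} = ⊤) (β : K) :
    ∃ p q : RatFunc k, β = algebraMap _ K p + algebraMap _ K q * δ := by
  have hint : IsIntegral (RatFunc k) δ := by
    refine IsIntegral.of_pow zero_lt_two ?_
    rw [hδ, IsScalarTower.algebraMap_apply k[X] (RatFunc k) K]
    exact isIntegral_algebraMap
  let f := QuadraticAlgebra.lift (R := RatFunc k) (A := K) (a := algebraMap k[X] _ D) (b := 0)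
    ⟨δ, by rw [← sq, hδ, zero_smul, add_zero, Algebra.smul_def, mul_one,
      ← IsScalarTower.algebraMap_apply]⟩
  have hle : Algebra.adjoin (RatFunc k) {δ} ≤ f.range := by
    refine Algebra.adjoin_le ?_
    rw [Set.singleton_subset_iff]
    exact ⟨⟨0, 1⟩, by simp [f]⟩
  rw [← IntermediateField.adjoin_simple_toSubalgebra_of_isAlgebraic hint.isAlgebraic, htop] at hle
  obtain ⟨⟨p, q⟩, h⟩ := hle (IntermediateField.mem_top : β ∈ ⊤)
  refine ⟨p, q, ?_⟩
  rw [← h]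
  simp [f, Algebra.smul_def]

theorem eq_zero_of_add_mul_eq_zero (hD : Squarefree D) (hdeg : 0 < D.natDegree)
    (hδ : δ ^ 2 = algebraMap k[X] K D) {p q : RatFunc k}
    (h : algebraMap _ K p + algebraMap _ K q * δ = 0) : p = 0 ∧ q = 0 := by
  have hq : q = 0 := by
    by_contra hq
    refine not_isSquare_algebraMap_ratFunc hD hdeg (p / q) ?_
    have h1 : algebraMap _ K (p ^ 2) = algebraMap _ K (q ^ 2 * algebraMap k[X] _ D) := by
      rw [map_mul, ← IsScalarTower.algebraMap_apply, ← hδ, map_pow, map_pow]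
      linear_combination (algebraMap _ K p - algebraMap _ K q * δ) * h
    have h1 := (algebraMap (RatFunc k) K).injective h1
    rw [div_pow, h1, mul_div_cancel_left₀ _ (pow_ne_zero 2 hq)]
  subst hq
  rw [map_zero, zero_mul, add_zero, map_eq_zero] at h
  exact ⟨h, rfl⟩

/-- For q ≠ 0 the minimal polynomial X² - 2pX + (p² - Dq²) has coefficients in k[T]. Halving the
trace gives p, and then Dq² is a polynomial. -/
theorem exists_polynomials_of_isIntegral (h2 : (2 : k) ≠ 0) (hD : Squarefree D)
    (hdeg : 0 < D.natDegree) (hδ : δ ^ 2 = algebraMap k[X] K D) {p q : RatFunc k}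
    (hint : IsIntegral k[X] (algebraMap _ K p + algebraMap _ K q * δ)) :
    ∃ u v : k[X], algebraMap _ _ u = p ∧ algebraMap _ _ v = q := by
  by_cases hq : q = 0
  · subst hq
    rw [map_zero, zero_mul, add_zero,
      isIntegral_algebraMap_iff (algebraMap (RatFunc k) K).injective] at hint
    obtain ⟨u, hu⟩ := IsIntegrallyClosed.isIntegral_iff.1 hint
    exact ⟨u, 0, hu, map_zero _⟩
  set β := algebraMap _ K p + algebraMap _ K q * δ with hβ
  set d := algebraMap k[X] (RatFunc k) D with hd
  have hintk : IsIntegral (RatFunc k) β := hint.tower_top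
  have h2le : 2 ≤ (minpoly (RatFunc k) β).natDegree := by
    rw [minpoly.two_le_natDegree_iff hintk]
    rintro ⟨r, hr⟩
    refine hq (eq_zero_of_add_mul_eq_zero hD hdeg hδ (p := p - r) (q := q) ?_).2
    rw [map_sub, hr, hβ]; ring
  set Q : (RatFunc k)[X] := X ^ 2 + C (-2 * p) * X + C (p ^ 2 - d * q ^ 2) with hQ
  have hQm : Q.Monic := by rw [hQ]; monicity!
  have hQd : Q.natDegree ≤ 2 := by rw [hQ]; compute_degree
  have hδ' : δ ^ 2 = algebraMap _ K d := by rw [hδ, hd, ← IsScalarTower.algebraMap_apply]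
  have hQβ : aeval β Q = 0 := by
    simp only [hQ, map_add, map_mul, map_pow, aeval_X, aeval_C, map_sub, map_neg, map_ofNat]
    rw [hβ]
    linear_combination (algebraMap _ K q) ^ 2 * hδ'
  have hmin : Q = minpoly (RatFunc k) β :=
    eq_of_monic_of_dvd_of_natDegree_le (minpoly.monic hintk) hQm (minpoly.dvd _ _ hQβ)
      (hQd.trans h2le)
  rw [minpoly.isIntegrallyClosed_eq_field_fractions' (RatFunc k) hint] at hmin
  have hc0 := congrArg (coeff · 0) hmin
  have hc1 := congrArg (coeff · 1) hmin
  simp only [coeff_map] at hc0 hc1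
  have e0 : Q.coeff 0 = p ^ 2 - d * q ^ 2 := by
    simp only [hQ, coeff_add, coeff_X_pow, coeff_C_mul, coeff_C, coeff_X]; norm_num
  have e1 : Q.coeff 1 = -2 * p := by
    simp only [hQ, coeff_add, coeff_X_pow, coeff_C_mul, coeff_C, coeff_X]; norm_num
  rw [e0] at hc0
  rw [e1] at hc1
  set s := (minpoly k[X] β).coeff 0
  set t := (minpoly k[X] β).coeff 1
  have hhalf : algebraMap k[X] (RatFunc k) (C (2⁻¹)) * 2 = 1 := by
    rw [← map_ofNat (algebraMap k[X] (RatFunc k)) 2, ← map_mul,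
      show (2 : k[X]) = C 2 from rfl, ← C_mul, inv_mul_cancel₀ h2, C_1, map_one]
  have hp : algebraMap k[X] (RatFunc k) (-C (2⁻¹) * t) = p := by
    rw [map_mul, map_neg, ← hc1]
    linear_combination p * hhalf
  obtain ⟨v, hv⟩ := exists_polynomial_of_mul_sq (q := q) hD (t := (-C (2⁻¹) * t) ^ 2 - s) (by
    rw [map_sub, map_pow, hp, ← hc0]; ring)
  exact ⟨_, v, hp, hv⟩

/-- If `D` is square-free and nonconstant and the characteristic is not two, then the ring of
integers of `k(T)(√D)` is `k[T][√D]`. -/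
theorem nonempty_quadraticAlgebra_ringEquiv (h2 : (2 : k) ≠ 0) (hD : Squarefree D)
    (hdeg : 0 < D.natDegree) (hK : IsAdjoinSqrt k K D) :
    Nonempty (QuadraticAlgebra k[X] D 0 ≃+* FunctionField.ringOfIntegers k K) := by
  obtain ⟨δ, hδ, htop⟩ := hK
  let f := QuadraticAlgebra.lift (R := k[X]) (A := K) (a := D) (b := 0)
    ⟨δ, by rw [← sq, hδ, zero_smul, add_zero, Algebra.smul_def, mul_one]⟩
  have hf : ∀ z, f z = algebraMap _ K z.re + algebraMap _ K z.im * δ := by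
    intro z
    simp [f, Algebra.smul_def]
  have hδint : IsIntegral k[X] δ :=
    IsIntegral.of_pow zero_lt_two (hδ ▸ isIntegral_algebraMap)
  have hmem : ∀ z, f z ∈ FunctionField.ringOfIntegers k K := by
    intro z
    rw [hf]
    exact isIntegral_algebraMap.add (isIntegral_algebraMap.mul hδint)
  refine ⟨(RingEquiv.ofBijective (f.codRestrict (FunctionField.ringOfIntegers k K) hmem) ⟨?_, ?_⟩)⟩
  · rw [AlgHom.injective_codRestrict, injective_iff_map_eq_zero]
    intro z hz
    rw [hf, IsScalarTower.algebraMap_apply k[X] (RatFunc k) K,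
      IsScalarTower.algebraMap_apply k[X] (RatFunc k) K] at hz
    obtain ⟨h1, h2⟩ := eq_zero_of_add_mul_eq_zero hD hdeg hδ hz
    rw [map_eq_zero_iff _ (IsFractionRing.injective k[X] (RatFunc k))] at h1 h2
    exact QuadraticAlgebra.ext h1 h2
  · rintro ⟨β, hβ⟩
    obtain ⟨p, q, rfl⟩ := exists_eq_add_mul_of_adjoin_eq_top hδ htop β
    obtain ⟨u, v, rfl, rfl⟩ := exists_polynomials_of_isIntegral h2 hD hdeg hδ hβ
    refine ⟨⟨u, v⟩, Subtype.ext ?_⟩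
    simp only [AlgHom.coe_codRestrict, hf, ← IsScalarTower.algebraMap_apply]

/-- X² - D is separable away from characteristic two, so K is finite and separable over k(T). -/
theorem isDedekindDomain_ringOfIntegers_of_isAdjoinSqrt (h2 : (2 : k) ≠ 0) (hD0 : D ≠ 0)
    (hK : IsAdjoinSqrt k K D) : IsDedekindDomain (FunctionField.ringOfIntegers k K) := by
  obtain ⟨δ, hδ, htop⟩ := hK
  set d := algebraMap k[X] (RatFunc k) D with hd
  have hd0 : d ≠ 0 :=
    (map_ne_zero_iff _ (IsFractionRing.injective k[X] (RatFunc k))).2 hD0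
  have h2' : ((2 : ℕ) : RatFunc k) ≠ 0 := by
    rw [← map_natCast (algebraMap k (RatFunc k))]
    exact (_root_.map_ne_zero _).2 (by exact_mod_cast h2)
  have hδ' : aeval δ (X ^ 2 - C d) = 0 := by
    rw [map_sub, map_pow, aeval_X, aeval_C, hδ, hd, ← IsScalarTower.algebraMap_apply, sub_self]
  have hsep : IsSeparable (RatFunc k) δ :=
    (separable_X_pow_sub_C d h2' hd0).of_dvd (minpoly.dvd _ _ hδ')
  have hsep' := (IntermediateField.isSeparable_adjoin_simple_iff_isSeparable (RatFunc k) K).2 hsep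
  have hfin := IntermediateField.adjoin.finiteDimensional hsep.isIntegral
  rw [htop] at hsep' hfin
  have : Algebra.IsSeparable (RatFunc k) K :=
    AlgEquiv.Algebra.isSeparable IntermediateField.topEquiv
  have : FunctionField k K :=
    Module.Finite.equiv (IntermediateField.topEquiv (F := RatFunc k) (E := K)).toLinearEquiv
  infer_instance

end

/-! ### The general family and its special cases -/

section

variable {Fq K : Type*} [Field Fq] [Field K] [Algebra Fq[X] K]

theorem hasCyclicClassSubgroup_of_orderOf {n : ℕ}
    (h : ∃ g : IdealClassGroup Fq K, orderOf g = n) : HasCyclicClassSubgroup Fq K n := by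
  obtain ⟨g, rfl⟩ := h
  exact ⟨Subgroup.zpowers g, inferInstance, Nat.card_zpowers g⟩

variable [Algebra (RatFunc Fq) K]

theorem IsAdjoinSqrt.of_sq_mul [IsScalarTower Fq[X] (RatFunc Fq) K] {D D' : Fq[X]} {c : Fq}
    (hc : c ≠ 0) (h : D = C c ^ 2 * D') (hK : IsAdjoinSqrt Fq K D) : IsAdjoinSqrt Fq K D' := by
  obtain ⟨δ, hδ, htop⟩ := hK
  have hcc : algebraMap Fq[X] K (C c⁻¹) * algebraMap Fq[X] K (C c) = 1 := by
    rw [← map_mul, ← C_mul, inv_mul_cancel₀ hc, C_1, map_one]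
  refine ⟨algebraMap Fq[X] K (C c⁻¹) * δ, ?_, ?_⟩
  · rw [mul_pow, hδ, h, map_mul, map_pow]
    linear_combination (algebraMap Fq[X] K D') *
      (algebraMap Fq[X] K (C c⁻¹) * algebraMap Fq[X] K (C c) + 1) * hcc
  · rw [eq_top_iff, ← htop, IntermediateField.adjoin_simple_le_iff]
    have h1 := (IntermediateField.adjoin (RatFunc Fq)
      {algebraMap Fq[X] K (C c⁻¹) * δ}).mul_mem
        (IntermediateField.algebraMap_mem _ (algebraMap Fq[X] (RatFunc Fq) (C c)))
        (IntermediateField.mem_adjoin_simple_self _ _)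
    rwa [← IsScalarTower.algebraMap_apply, ← mul_assoc, mul_comm (algebraMap Fq[X] K (C c)), hcc,
      one_mul] at h1

/-- In characteristic two a polynomial of the form considered is a square, hence not
square-free. -/
theorem two_ne_zero_of_squarefree {W F : Fq[X]} {a b : Fq}
    (hW : 0 < W.natDegree) (ha : a ≠ 0) (hF : F ∣ W - C b) (hA : W + C a * F - C b ≠ 0)
    (hD : Squarefree ((W + C a * F - C b) ^ 2 + 4 * C a * C b * F)) : (2 : Fq) ≠ 0 := by
  intro h2
  have h4 : (4 : Fq[X]) = 0 := by
    rw [show (4 : Fq[X]) = C 2 * 2 by rw [show (C 2 : Fq[X]) = 2 from rfl]; norm_num, h2, C_0,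
      zero_mul]
  rw [h4, zero_mul, zero_mul, zero_mul, add_zero, sq] at hD
  have h1 := natDegree_eq_zero_of_isUnit (hD _ dvd_rfl)
  rw [(natDegree_eq_of_dvd hW ha hF hA).2.2.2] at h1
  omega

theorem hasCyclicClassSubgroup_of_eq [IsScalarTower Fq[X] (RatFunc Fq) K] {n : ℕ} (hn : 1 ≤ n)
    {Z D F : Fq[X]} {a b : Fq} (hZ : 0 < Z.natDegree) (hD : Squarefree D)
    (hK : IsAdjoinSqrt Fq K D) (ha : a ≠ 0) (hb : b ≠ 0) (hF : F ∣ Z ^ n - C b)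
    (hA : Z ^ n + C a * F - C b ≠ 0)
    (hDeq : D = (Z ^ n + C a * F - C b) ^ 2 + 4 * C a * C b * F) :
    HasCyclicClassSubgroup Fq K n := by
  have hW : 0 < (Z ^ n).natDegree := by
    rw [natDegree_pow]; exact Nat.mul_pos hn hZ
  have h2 : (2 : Fq) ≠ 0 := two_ne_zero_of_squarefree hW ha hF hA (hDeq ▸ hD)
  apply hasCyclicClassSubgroup_of_orderOf
  rcases hn.eq_or_lt with rfl | hn
  -- The coprimality argument needs n ≥ 2; for n = 1 the trivial class suffices.
  · exact ⟨1, orderOf_one⟩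
  have := isDedekindDomain_ringOfIntegers_of_isAdjoinSqrt h2 hD.ne_zero hK
  obtain ⟨e⟩ := nonempty_quadraticAlgebra_ringEquiv h2 hD
    (hDeq ▸ natDegree_discriminant_pos hW ha hF hA) hK
  exact exists_orderOf_eq_of_quadraticAlgebra h2 hn hZ ha hb hF hA hD hDeq e

end

theorem theorem2 {Fq : Type*} [Field Fq] [Finite Fq] {K : Type*} [Field K]
    [Algebra Fq[X] K] [Algebra (RatFunc Fq) K] [IsScalarTower Fq[X] (RatFunc Fq) K]
    (n : ℕ) (hn : 1 ≤ n) (Z : Fq[X]) (hZ : 0 < Z.natDegree)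
    (D : Fq[X]) (hD : Squarefree D) (hK : IsAdjoinSqrt Fq K D) :
    (D.Monic → D = Z ^ (2 * n) + 1 → HasCyclicClassSubgroup Fq K n) ∧
    (∀ F : Fq[X], D.Monic → F ∣ Z ^ n - 1 → Z ^ n + F - 1 ≠ 0 →
      D = (Z ^ n + F - 1) ^ 2 + 4 * F → HasCyclicClassSubgroup Fq K n) ∧
    (∀ F : Fq[X], D.Monic → F ∣ Z ^ n + 1 → Z ^ n - F + 1 ≠ 0 →
      D = (Z ^ n - F + 1) ^ 2 + 4 * F → HasCyclicClassSubgroup Fq K n) ∧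
    (∀ F : Fq[X], D.Monic → F ∣ 4 * Z ^ n - 1 → 4 * Z ^ n + F - 1 ≠ 0 →
      D = (4 * Z ^ n + F - 1) ^ 2 + 4 * F → HasCyclicClassSubgroup Fq K n) ∧
    (∀ (a b : Fq) (F : Fq[X]), a ≠ 0 → b ≠ 0 → F ∣ Z ^ n - C b → Z ^ n + C a * F - C b ≠ 0 →
      D = (Z ^ n + C a * F - C b) ^ 2 + 4 * C a * C b * F → HasCyclicClassSubgroup Fq K n) := by
  have hW : (Z ^ n).natDegree = n * Z.natDegree := natDegree_pow _ _
  have hnZ : 0 < n * Z.natDegree := Nat.mul_pos hn hZ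
  have hZn : Z ^ n ≠ 0 := by
    intro h
    rw [h, natDegree_zero] at hW
    omega
  have hC2 : (C 2 : Fq[X]) = 2 := rfl
  have hC4 : (C 4 : Fq[X]) = 4 := rfl
  refine ⟨fun _ h => ?_, fun F _ hF hA h => ?_, fun F _ hF hA h => ?_, fun F hm hF hA h => ?_,
    fun a b F ha hb hF hA h => hasCyclicClassSubgroup_of_eq hn hZ hD hK ha hb hF hA h⟩
  · have h2 : (2 : Fq) ≠ 0 := by
      intro h2
      have h20 : (2 : Fq[X]) = 0 := by rw [← hC2, h2, C_0]
      have hu : IsUnit (Z ^ n + 1) := hD _ ⟨1, by rw [h]; linear_combination (-Z ^ n) * h20⟩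
      have h1 := natDegree_eq_zero_of_isUnit hu
      rw [← C_1, natDegree_add_C] at h1
      omega
    have hh : C (2⁻¹ : Fq) * 2 = 1 := by rw [← hC2, ← C_mul, inv_mul_cancel₀ h2, C_1]
    -- With b = F = 1/2 the linear terms cancel: A = Z^n and 4abF = 1.
    refine hasCyclicClassSubgroup_of_eq (a := 1) (b := 2⁻¹) (F := C 2⁻¹) hn hZ hD hK one_ne_zero
      (inv_ne_zero h2) (isUnit_C.2 (inv_ne_zero h2).isUnit).dvd ?_ ?_
    · rwa [C_1, one_mul, add_sub_cancel_right]
    · rw [h, C_1]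
      linear_combination (-(C (2⁻¹ : Fq) * 2) - 1) * hh
  · refine hasCyclicClassSubgroup_of_eq (a := 1) (b := 1) (F := F) hn hZ hD hK one_ne_zero
      one_ne_zero ?_ ?_ ?_
    · rwa [C_1]
    · rwa [C_1, one_mul]
    · rw [h, C_1]; ring
  · have hn1 : (-1 : Fq) ≠ 0 := neg_ne_zero.2 one_ne_zero
    refine hasCyclicClassSubgroup_of_eq (a := -1) (b := -1) (F := F) hn hZ hD hK hn1 hn1 ?_ ?_ ?_
    · rwa [C_neg, C_1, sub_neg_eq_add]
    · rwa [C_neg, C_1, sub_neg_eq_add, neg_one_mul, ← sub_eq_add_neg]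
    · rw [h, C_neg, C_1]; ring
  -- In characteristic two F is a nonzero constant f and D = (f - 1)²; monicity gives (f - 1)² = 1,
  -- so f² = 0.
  · have h2 : (2 : Fq) ≠ 0 := by
      intro h2
      have h20 : (2 : Fq[X]) = 0 := by rw [← hC2, h2, C_0]
      have hFu : IsUnit F := isUnit_of_dvd_one (by
        have : (4 : Fq[X]) * Z ^ n - 1 = -1 := by linear_combination 2 * Z ^ n * h20
        rwa [this, dvd_neg] at hF)
      have hsq : D = (F - 1) ^ 2 := by
        rw [h]
        linear_combination (8 * Z ^ (2 * n) + 4 * Z ^ n * (F - 1) + 2 * F) * h20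
      obtain ⟨f, hf, rfl⟩ := Polynomial.isUnit_iff.1 hFu
      rw [hsq, ← C_1, ← C_sub, ← C_pow, Monic, leadingCoeff_C] at hm
      have : f ^ 2 = 0 := by linear_combination hm + f * h2
      exact hf.ne_zero (pow_eq_zero_iff two_ne_zero |>.1 this)
    have h4 : (4 : Fq) ≠ 0 := by
      rw [show (4 : Fq) = 2 * 2 by norm_num]; exact mul_ne_zero h2 h2
    have hh : C (4⁻¹ : Fq) * 4 = 1 := by rw [← hC4, ← C_mul, inv_mul_cancel₀ h4, C_1]
    have hAe : C (4⁻¹ : Fq) * (4 * Z ^ n + F - 1) = Z ^ n + C 4⁻¹ * F - C 4⁻¹ := by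
      linear_combination Z ^ n * hh
    -- D is 16 times a member of the general family with a = b = 1/4, and √D and √D/4 generate the
    -- same field.
    have hDe : D = C 4 ^ 2 * ((Z ^ n + C 4⁻¹ * F - C 4⁻¹) ^ 2 + 4 * C 4⁻¹ * C 4⁻¹ * F) := by
      rw [← hAe, h, hC4]
      linear_combination (-((4 * Z ^ n + F - 1) ^ 2 + 4 * F) * (C (4⁻¹ : Fq) * 4 + 1)) * hh
    refine hasCyclicClassSubgroup_of_eq (a := 4⁻¹) (b := 4⁻¹) (F := F) hn hZ
      (hD.squarefree_of_dvd (Dvd.intro_left _ hDe.symm)) (hK.of_sq_mul h4 hDe) (inv_ne_zero h4)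
      (inv_ne_zero h4) ?_ ?_ rfl
    · have : Z ^ n - C (4⁻¹ : Fq) = C 4⁻¹ * (4 * Z ^ n - 1) := by
        linear_combination (-Z ^ n) * hh
      rw [this]
      exact hF.mul_left _
    · rw [← hAe]
      exact mul_ne_zero (C_ne_zero.2 (inv_ne_zero h4)) hA
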